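/- Let $U$ be an optimal programming language for conditional plain Kolmogorov complexity, that is, a partial computable function $U(p,y)$ of two binary strings with values in binary strings, such that for every partial computable $V$ of this kind there is a constant $c$ such that whenever $V(p,y)=x$ there is a $q$ with $U(q,y)=x$ and $|q|\le |p|+c$. Let $C(x\mid y)=\min\{|p| : U(p,y)=x\}$ and let $C(x)=C(x\mid \text{empty string})$. For a tuple of strings, $C(x_1,\ldots,x_s)$ denotes the complexity of the string $\langle x_1,\ldots,x_s\rangle$ that encodes the tuple: the concatenation of the self-delimiting codes $1b_1\,1b_2\ldots 1b_m\,0$ of its entries $b_1b_2\ldots b_m$. Let $\lambda\in(0,1)$. Assume that for every $k$ there is a constant $c_k$ such that for every $k$-tuple of binary strings $(y_1,\ldots,y_k)$ there exists a binary string $z$ such that \[ \bigl|C(y_i\mid z)-\lambda\,C(y_i)\bigr|\le c_k\log\bigl(C(y_1,\ldots,y_k)+2\bigr)\quad\text{for all } i=1,\ldots,k . \] Then for every $n$ there is a constant $c'_n$ such that for every $n$-tuple of binary strings $(x_1,\ldots,x_n)$ there exists an $n$-tuple of binary strings $(x'_1,\ldots,x'_n)$ such that \[ \bigl|C(x'_{i_1},\ldots,x'_{i_s})-\lambda\,C(x_{i_1},\ldots,x_{i_s})\bigr|\le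 c'_n\log\bigl(C(x_1,\ldots,x_n)+2\bigr) \] for all $s\ge 1$ and all $1\le i_1<\ldots<i_s\le n$. -/

import Mathlib

/-- A description method (conditional decompressor): it takes a binary program and a binary
condition, and possibly outputs a binary string. -/
abbrev DescriptionMethod : Type := List Bool × List Bool →. List Bool

/-- `U` is an optimal programming language: it is partial computable, and for every partial
computable description method `V` there is a constant `c` such that every `V`-program for `x`
under condition `y` can be replaced by a `U`-program for `x` under the same condition that is
longer by at most `c`. -/
def IsOptimal (U : DescriptionMethod) : Prop :=
  Partrec U ∧
    ∀ V : DescriptionMethod, Partrec V →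
      ∃ c : ℕ, ∀ x y p : List Bool, x ∈ V (p, y) →
        ∃ q : List Bool, x ∈ U (q, y) ∧ q.length ≤ p.length + c

/-- Conditional plain Kolmogorov complexity `C(x | y)` with respect to `U`: the minimal length of
a program that outputs `x` given `y`. (If `U` is optimal, such programs exist, see
`IsOptimal.exists_program`.) -/
noncomputable def condComplexity (U : DescriptionMethod) (x y : List Bool) : ℕ :=
  sInf {l : ℕ | ∃ p : List Bool, p.length = l ∧ x ∈ U (p, y)}

/-- Plain Kolmogorov complexity `C(x)`: the condition is the empty string. -/
noncomputable def complexity (U : DescriptionMethod) (x : List Bool) : ℕ :=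
  condComplexity U x []

/-- Self-delimiting code of a string: `b₁ … bₘ` becomes `1 b₁ 1 b₂ … 1 bₘ 0`. -/
def selfDelimiting (x : List Bool) : List Bool :=
  x.flatMap (fun b => [true, b]) ++ [false]

/-- The code of a finite tuple of strings: the concatenation of the self-delimiting codes of its
entries. -/
def tupleCode (xs : List (List Bool)) : List Bool :=
  xs.flatMap selfDelimiting

/-- The complexity `C(x_{i₁}, …, x_{iₛ})` of the subtuple of `x = (x₁, …, xₙ)` with index set
`J = {i₁ < … < iₛ}`. -/
noncomputable def tupleComplexity (U : DescriptionMethod) {n : ℕ} (x : Fin n → List Bool)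
    (J : Finset (Fin n)) : ℕ :=
  complexity U (tupleCode ((J.sort (· ≤ ·)).map x))

theorem selfDelimiting_append_inj (x y s t : List Bool)
    (h : selfDelimiting x ++ s = selfDelimiting y ++ t) : x = y ∧ s = t := by
  induction x generalizing y with
  | nil => cases y with
    | nil => simpa [selfDelimiting] using h
    | cons b y => simp [selfDelimiting] at h
  | cons a x ih => cases y with
    | nil => simp [selfDelimiting] at h
    | cons b y =>
      simp only [selfDelimiting, List.flatMap_cons, List.cons_append, List.nil_append,
        List.cons.injEq, true_and] at h
      obtain ⟨h1, h2⟩ := ih y (by simpa [selfDelimiting] using h.2)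
      exact ⟨by rw [h.1, h1], h2⟩

theorem tupleCode_injective : Function.Injective tupleCode := by
  intro xs
  induction xs with
  | nil => intro ys h
           cases ys with
           | nil => rfl
           | cons y ys => simp [tupleCode, selfDelimiting] at h
  | cons x xs ih =>
    intro ys h
    cases ys with
    | nil => simp [tupleCode, selfDelimiting] at h
    | cons y ys =>
      obtain ⟨h1, h2⟩ := selfDelimiting_append_inj x y _ _ h
      rw [h1, ih h2]

theorem IsOptimal.exists_program {U : DescriptionMethod} (hU : IsOptimal U) (x y : List Bool) :
    ∃ p : List Bool, x ∈ U (p, y) := by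
  obtain ⟨c, hc⟩ := hU.2 (fun a => Part.some a.1) Computable.fst
  obtain ⟨q, hq, -⟩ := hc x y x (Part.mem_some x)
  exact ⟨q, hq⟩

/-- Optimal programming languages exist: a program `1ᵉ 0 p` is run by applying the partial
computable function with index `e` to `p` and the condition. -/
theorem exists_isOptimal : ∃ U : DescriptionMethod, IsOptimal U := by
  let idx : List Bool → ℕ := fun p => p.findIdx (fun b => !b)
  have hidx : Primrec idx := by
    refine Primrec.list_findIdx Primrec.id ?_
    exact (Primrec.not.comp Primrec.snd)
  let rest : List Bool → List Bool := fun p => List.tail^[idx p + 1] p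
  have hrest : Primrec rest :=
    Primrec.nat_iterate (Primrec.succ.comp hidx) Primrec.id
      (Primrec.list_tail.comp Primrec.snd)
  refine ⟨fun a => ((Denumerable.ofNat Nat.Partrec.Code (idx a.1)).eval
      (Encodable.encode (rest a.1, a.2))).bind
      fun m => ((Encodable.decode m : Option (List Bool)) : Part (List Bool)), ?_, ?_⟩
  · refine Partrec.bind (Nat.Partrec.Code.eval_part.comp ?_ ?_) ?_
    · exact ((Primrec.ofNat _).comp (hidx.comp Primrec.fst)).to_comp
    · exact (Primrec.encode.comp
        ((hrest.comp Primrec.fst).pair Primrec.snd)).to_comp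
    · exact (Computable.decode.comp Computable.snd).ofOption
  · intro V hV
    obtain ⟨e, he⟩ := Nat.Partrec.Code.exists_code.1 hV
    refine ⟨Encodable.encode e + 1, fun x y p hx => ?_⟩
    have h1 : ∀ k : ℕ, idx (List.replicate k true ++ false :: p) = k := by
      intro k
      induction k with
      | zero => simp [idx, List.findIdx_cons]
      | succ k ih =>
        simp only [idx] at ih
        simp [idx, List.replicate_succ, List.findIdx_cons, ih]
    have h2 : ∀ k : ℕ, List.tail^[k + 1] (List.replicate k true ++ false :: p) = p := by
      intro k
      induction k with
      | zero => simp
      | succ k ih => rw [Function.iterate_succ_apply]; simpa [List.replicate_succ] using ih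
    refine ⟨List.replicate (Encodable.encode e) true ++ false :: p, ?_, ?_⟩
    · simp only [rest, h1, h2, Denumerable.ofNat_encode, he]
      simp only [Encodable.encodek, Part.coe_some, Part.bind_some, Part.mem_bind_iff]
      exact ⟨Encodable.encode x, Part.mem_map _ hx, by simp⟩
    · simp; omega

/-! Apply the hypothesis not to the entries of `x` but to the codes of all its subtuples, one for
each subset of indices. This gives a single `z` for which every conditional complexity `k j = C(π j
x | z)` is close to `λ C(π j x)`. It remains to find `x'` whose unconditional profile is close to
`k`, with an error linear in `codeSize k`, hence logarithmic (`IsOptimal.exists_unconditional`).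

This passage from complexity to finite combinatorics and back has two halves. In
`IsOptimal.exists_typical_finset`, the objects `y` with `C(π j y | z) ≤ k j` for all `j`, thinned to
those with small sections, form a set `T` with about `2 ^ k top` elements, at most `2 ^ (k j + 1)`
values of `π j`, and sections of size about `2 ^ (k top - k j)`. The section bounds cost nothing
essential: a value with a larger section would be simpler than `k j`, so `x` survives the thinning;
and `T`, being enumerable given `z` and containing `x`, cannot be small.

The existence of a finite set with such sizes no longer mentions `z`. In
`IsOptimal.exists_complexity_of_isModel`, the first such set found by exhaustive search is therefore
described by the numerical parameters alone. By counting it has a member `x'` of complexity about `k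
top`. The sizes of projections bound `C(π j x')` from above. The sizes of sections bound it from
below, since `x'` is determined by `π j x'` and an index in its section.

The engine throughout is `IsOptimal.exists_condComplexity_le_of_card`: a member of an enumerable set
is described by its position in the enumeration. -/

open Encodable

/-! ### Primitive recursive predicates -/

section Primrec

variable {α β σ : Type*} [Primcodable α] [Primcodable β] [Primcodable σ]

theorem PrimrecPred.exists_mem {f : α → List β} {R : α → β → Prop} (hf : Primrec f)
    (hR : PrimrecRel R) : PrimrecPred fun a => ∃ b ∈ f a, R a b :=
  hR.swap.exists_mem_list.comp hf Primrec.id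

theorem PrimrecPred.forall_mem {f : α → List β} {R : α → β → Prop} (hf : Primrec f)
    (hR : PrimrecRel R) : PrimrecPred fun a => ∀ b ∈ f a, R a b :=
  hR.swap.forall_mem_list.comp hf Primrec.id

theorem Primrec.list_filter {f : α → List β} {R : α → β → Prop} [∀ a, DecidablePred (R a)]
    (hf : Primrec f) (hR : PrimrecRel R) :
    Primrec fun a => (f a).filter fun b => decide (R a b) := by
  classical
  refine ((hR.swap.listFilter (R := fun b a => R a b)).comp hf Primrec.id).of_eq fun a => ?_
  exact List.filter_congr fun b _ => by simp

theorem PrimrecRel.list_mem : PrimrecRel fun (y : α) (l : List α) => y ∈ l :=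
  PrimrecPred.of_eq (PrimrecPred.exists_mem (R := fun (q : α × List α) b => b = q.1) Primrec.snd
    (Primrec.eq.comp Primrec.snd (Primrec.fst.comp Primrec.fst))) fun q => by simp

theorem PrimrecPred.const (p : Prop) : PrimrecPred fun _ : α => p := by
  classical
  exact ⟨inferInstance, Primrec.const (decide p)⟩

theorem PrimrecPred.forall_fin {K : ℕ} {P : Fin K → α → Prop} (h : ∀ j, PrimrecPred (P j)) :
    PrimrecPred fun a => ∀ j, P j a := by
  induction K with
  | zero => exact (PrimrecPred.const True).of_eq fun a => by simp
  | succ K ih =>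
    exact ((h 0).and (ih fun j => h j.succ)).of_eq fun a => by rw [Fin.forall_fin_succ]

variable (α) in
/-- The list of all elements with code less than `t`. -/
def elementsBelow (t : ℕ) : List α :=
  (List.range t).filterMap (decode₂ α)

theorem mem_elementsBelow {t : ℕ} {a : α} : a ∈ elementsBelow α t ↔ encode a < t := by
  simp [elementsBelow, decode₂_eq_some]

theorem exists_mem_elementsBelow (a : α) : ∃ s, ∀ t, s ≤ t → a ∈ elementsBelow α t :=
  ⟨encode a + 1, fun _ ht => mem_elementsBelow.2 ht⟩

theorem nodup_elementsBelow (t : ℕ) : (elementsBelow α t).Nodup := by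
  refine List.Nodup.filterMap ?_ List.nodup_range
  intro n m a hn hm
  rw [mem_decode₂] at hn hm
  rw [← hn, hm]

theorem primrec_elementsBelow : Primrec (elementsBelow α) :=
  Primrec.listFilterMap Primrec.list_range (Primrec.decode₂.comp Primrec.snd).to₂

theorem Primrec.two_pow {f : α → ℕ} (hf : Primrec f) : Primrec fun a => 2 ^ f a :=
  (Primrec₂.unpaired'.1 Nat.Primrec.pow).comp (Primrec.const 2) hf

end Primrec

/-! ### Binary numerals -/

/-- The number with the given binary digits, least significant digit first. -/
def bitsValue (l : List Bool) : ℕ :=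
  l.foldr (fun b s => cond b (2 * s + 1) (2 * s)) 0

theorem exists_bitsValue_eq (m i : ℕ) (h : i < 2 ^ m) :
    ∃ r : List Bool, r.length = m ∧ bitsValue r = i := by
  induction m generalizing i with
  | zero => exact ⟨[], rfl, by simp [bitsValue] at h ⊢; omega⟩
  | succ m ih =>
    obtain ⟨r, hr, hv⟩ := ih (i / 2) (by omega)
    rw [bitsValue] at hv
    rcases Nat.mod_two_eq_zero_or_one i with h0 | h0
    · exact ⟨false :: r, by simp [hr], by simp [bitsValue, hv]; omega⟩
    · exact ⟨true :: r, by simp [hr], by simp [bitsValue, hv]; omega⟩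

theorem primrec_bitsValue : Primrec bitsValue := by
  have h : Primrec₂ fun (_ : List Bool) (q : Bool × ℕ) => cond q.1 (2 * q.2 + 1) (2 * q.2) :=
    (Primrec.cond (Primrec.fst.comp Primrec.snd)
      (Primrec.nat_double_succ.comp (Primrec.snd.comp Primrec.snd))
      (Primrec.nat_double.comp (Primrec.snd.comp Primrec.snd))).to₂
  exact Primrec.list_foldr Primrec.id (Primrec.const 0) h

/-! ### Basic facts on complexity -/

section Complexity

variable {U : DescriptionMethod}

theorem condComplexity_le_length {x z p : List Bool} (h : x ∈ U (p, z)) :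
    condComplexity U x z ≤ p.length :=
  Nat.sInf_le ⟨p, rfl, h⟩

theorem IsOptimal.exists_shortest_program (hU : IsOptimal U) (x z : List Bool) :
    ∃ p : List Bool, p.length = condComplexity U x z ∧ x ∈ U (p, z) := by
  obtain ⟨p, hp⟩ := hU.exists_program x z
  exact Nat.sInf_mem (s := {l : ℕ | ∃ p : List Bool, p.length = l ∧ x ∈ U (p, z)})
    ⟨_, p, rfl, hp⟩

theorem IsOptimal.condComplexity_le_iff (hU : IsOptimal U) {x z : List Bool} {l : ℕ} :
    condComplexity U x z ≤ l ↔ ∃ p : List Bool, p.length ≤ l ∧ x ∈ U (p, z) := by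
  constructor
  · intro h
    obtain ⟨p, hp, hx⟩ := hU.exists_shortest_program x z
    exact ⟨p, hp.trans_le h, hx⟩
  · rintro ⟨p, hp, hx⟩
    exact (condComplexity_le_length hx).trans hp

theorem exists_finset_length_lt (l : ℕ) :
    ∃ S : Finset (List Bool), S.card < 2 ^ l ∧ ∀ p : List Bool, p.length < l → p ∈ S := by
  induction l with
  | zero => exact ⟨∅, by simp, by simp⟩
  | succ l ih =>
    obtain ⟨S, hS, h⟩ := ih
    refine ⟨insert [] (S.image (List.cons true) ∪ S.image (List.cons false)), ?_, ?_⟩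
    · have h1 := Finset.card_insert_le ([] : List Bool)
        (S.image (List.cons true) ∪ S.image (List.cons false))
      have h2 := Finset.card_union_le (S.image (List.cons true)) (S.image (List.cons false))
      have h3 := Finset.card_image_le (s := S) (f := List.cons true)
      have h4 := Finset.card_image_le (s := S) (f := List.cons false)
      rw [pow_succ]
      omega
    · intro p hp
      cases p with
      | nil => simp
      | cons b p =>
        have := h p (by simpa using hp)
        cases b <;> simp [this]

/-- Fewer than `2 ^ l` strings have complexity less than `l`. -/
theorem IsOptimal.exists_finset_condComplexity_lt (hU : IsOptimal U) (z : List Bool) (l : ℕ) :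
    ∃ S : Finset (List Bool), S.card < 2 ^ l ∧ ∀ x, condComplexity U x z < l → x ∈ S := by
  classical
  obtain ⟨S, hS, h⟩ := exists_finset_length_lt l
  refine ⟨S.image fun p => (U (p, z)).getOrElse [], Finset.card_image_le.trans_lt hS, ?_⟩
  intro x hx
  obtain ⟨p, hp, hxp⟩ := hU.exists_shortest_program x z
  refine Finset.mem_image.2 ⟨p, h p (hp.trans_lt hx), ?_⟩
  rw [Part.eq_some_iff.2 hxp, Part.getOrElse_some]

/-- The predicate `C(x | z) ≤ l` is recursively enumerable. -/
theorem IsOptimal.exists_stage (hU : IsOptimal U) :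
    ∃ D : (ℕ × List Bool) × List Bool → ℕ → Prop, PrimrecRel D ∧
      (∀ q s t, s ≤ t → D q s → D q t) ∧
      ∀ l x z, condComplexity U x z ≤ l ↔ ∃ t, D ((l, z), x) t := by
  obtain ⟨e, he⟩ := Nat.Partrec.Code.exists_code.1 hU.1
  have hmem : ∀ p z x, x ∈ U (p, z) ↔ ∃ t, encode x ∈ e.evaln t (encode (p, z)) := by
    intro p z x
    rw [← Nat.Partrec.Code.evaln_complete, he]
    simp
  -- The stage `t` bounds both the code of the program and its running time, which makes the
  -- predicate primitive recursive and monotone in `t`.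
  refine ⟨fun q t => ∃ p ∈ elementsBelow (List Bool) t, p.length ≤ q.1.1 ∧
    e.evaln t (encode (p, q.1.2)) = some (encode q.2), ?_, ?_, ?_⟩
  · refine PrimrecPred.exists_mem (primrec_elementsBelow.comp Primrec.snd) ?_
    refine PrimrecPred.and ?_ ?_
    · exact Primrec.nat_le.comp (Primrec.list_length.comp Primrec.snd)
        (Primrec.fst.comp <| Primrec.fst.comp <| Primrec.fst.comp Primrec.fst)
    · refine Primrec.eq.comp (Nat.Partrec.Code.primrec_evaln.comp
        (((Primrec.snd.comp Primrec.fst).pair (Primrec.const e)).pair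
          (Primrec.encode.comp (Primrec.snd.pair
            (Primrec.snd.comp <| Primrec.fst.comp <| Primrec.fst.comp Primrec.fst)))))
        (Primrec.option_some.comp <| Primrec.encode.comp <| Primrec.snd.comp <|
          Primrec.fst.comp Primrec.fst)
  · rintro q s t hst ⟨p, hp, hl, h⟩
    exact ⟨p, mem_elementsBelow.2 ((mem_elementsBelow.1 hp).trans_le hst), hl,
      Nat.Partrec.Code.evaln_mono hst h⟩
  · intro l x z
    rw [hU.condComplexity_le_iff]
    constructor
    · rintro ⟨p, hp, hx⟩
      obtain ⟨t, ht⟩ := (hmem p z x).1 hx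
      exact ⟨max t (encode p + 1), p, mem_elementsBelow.2 (by omega), hp,
        Nat.Partrec.Code.evaln_mono (le_max_left _ _) ht⟩
    · rintro ⟨t, p, -, hp, h⟩
      exact ⟨p, hp, (hmem p z x).2 ⟨t, h⟩⟩

/-- A computable function of a number `a`, a string `r` and the condition `z` has values of
complexity at most `|r| + 2 log a`, up to a constant. -/
theorem IsOptimal.exists_condComplexity_le (hU : IsOptimal U)
    {f : (ℕ × List Bool) × List Bool →. List Bool} (hf : Partrec f) :
    ∃ c, ∀ a r z x, x ∈ f ((a, r), z) →
      condComplexity U x z ≤ r.length + 2 * Nat.size a + c := by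
  -- Programs have the form `1ˢ 0 b r` with `|b| = s`, where `b` is the numeral of `a`: this
  -- accounts for twice the size of `a`, and the separator for the `+ 1` below.
  let idx : List Bool → ℕ := fun p => p.findIdx (fun b => !b)
  have hidx : Primrec idx :=
    Primrec.list_findIdx Primrec.id (Primrec.not.comp Primrec.snd)
  let rest : List Bool → List Bool := fun p => p.drop (idx p + 1)
  have hrest : Primrec rest := Primrec.list_drop.comp (Primrec.succ.comp hidx) Primrec.id
  have hV : Partrec fun q : List Bool × List Bool =>
      f ((bitsValue ((rest q.1).take (idx q.1)), (rest q.1).drop (idx q.1)), q.2) := by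
    refine hf.comp (Primrec.to_comp ?_)
    refine ((primrec_bitsValue.comp (Primrec.list_take.comp ?_ ?_)).pair
      (Primrec.list_drop.comp ?_ ?_)).pair Primrec.snd
    · exact hidx.comp Primrec.fst
    · exact hrest.comp Primrec.fst
    · exact hidx.comp Primrec.fst
    · exact hrest.comp Primrec.fst
  obtain ⟨c, hc⟩ := hU.2 _ hV
  refine ⟨c + 1, fun a r z x hx => ?_⟩
  obtain ⟨b, hb, hv⟩ := exists_bitsValue_eq (Nat.size a) a (Nat.lt_size_self a)
  have h1 : ∀ (k : ℕ) (p : List Bool), idx (List.replicate k true ++ false :: p) = k := by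
    intro k p
    induction k with
    | zero => simp [idx, List.findIdx_cons]
    | succ k ih =>
      simp only [idx] at ih
      simp [idx, List.replicate_succ, List.findIdx_cons, ih]
  have h2 : ∀ (k : ℕ) (p : List Bool), rest (List.replicate k true ++ false :: p) = p := by
    intro k p
    simp only [rest, h1]
    rw [List.drop_append]
    simp
  obtain ⟨q, hq, hl⟩ := hc x z (List.replicate (Nat.size a) true ++ false :: (b ++ r)) (by
    simp only [h1, h2]
    rw [List.take_left' hb, List.drop_left' hb, hv]
    exact hx)
  refine (condComplexity_le_length hq).trans (hl.trans ?_)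
  simp [hb]
  omega

end Complexity

/-! ### Enumerable families of sets -/

/-- The number of bits in the code of `a`, a bound for the cost of describing `a`. -/
def codeSize {β : Type*} [Primcodable β] (a : β) : ℕ :=
  Nat.size (encode a)

/-- The pairing function stays below `(max + 1) ^ 2`, so pairing at most doubles the number of bits.
-/
theorem codeSize_pair_le {β γ : Type*} [Primcodable β] [Primcodable γ] (a : β) (b : γ) :
    codeSize (a, b) ≤ 2 * (codeSize a + codeSize b) := by
  rw [codeSize, Nat.size_le, encode_prod_val]
  have h1 := Nat.lt_size_self (encode a)
  have h2 := Nat.lt_size_self (encode b)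
  have h3 : max (encode a) (encode b) + 1 ≤ 2 ^ (codeSize a + codeSize b) := by
    have h4 : 2 ^ codeSize a ≤ 2 ^ (codeSize a + codeSize b) :=
      Nat.pow_le_pow_right (by norm_num) (by omega)
    have h5 : 2 ^ codeSize b ≤ 2 ^ (codeSize a + codeSize b) :=
      Nat.pow_le_pow_right (by norm_num) (by omega)
    rw [← codeSize] at h1 h2
    omega
  refine (Nat.pair_lt_max_add_one_sq _ _).trans_le ?_
  rw [mul_comm, pow_mul]
  exact Nat.pow_le_pow_left h3 2

theorem codeSize_nat_le (n : ℕ) : codeSize n ≤ n := by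
  rw [codeSize, Nat.size_le]
  exact Nat.lt_two_pow_self

section Enumeration

variable {U : DescriptionMethod} {A β : Type*} [Primcodable A] [Primcodable β]

/-- If a recursively enumerable family of sets, with parameters `a`, `m` and condition `z`, has a
member with at most `2 ^ m` elements, then these elements have complexity at most `m` conditional
to `z`, up to the cost of the parameter `a`. -/
theorem IsOptimal.exists_condComplexity_le_of_card (hU : IsOptimal U)
    {D : (A × ℕ) × List Bool → β × ℕ → Prop} (hD : PrimrecRel D) {F : β → List Bool}
    (hF : Primrec F) :
    ∃ c, ∀ a m z (S : Finset β), (∀ b t, D ((a, m), z) (b, t) → b ∈ S) → S.card ≤ 2 ^ m →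
      ∀ b t, D ((a, m), z) (b, t) →
        condComplexity U (F b) z ≤ m + 2 * codeSize a + c := by
  classical
  -- Keeping only the first stage at which `b` appears makes the enumeration free of repetitions, so
  -- that the rank counts distinct elements.
  let R : (A × ℕ) × List Bool → β × ℕ → Prop := fun x w =>
    D x w ∧ ∀ t ∈ List.range w.2, ¬ D x (w.1, t)
  have hR : PrimrecRel R := by
    refine PrimrecPred.and hD (PrimrecPred.forall_mem
      (Primrec.list_range.comp (Primrec.snd.comp Primrec.snd)) (PrimrecPred.not ?_))
    exact hD.comp (Primrec.fst.comp Primrec.fst)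
      ((Primrec.fst.comp (Primrec.snd.comp Primrec.fst)).pair Primrec.snd)
  let rank : (A × ℕ) × List Bool → ℕ → ℕ := fun x n =>
    ((elementsBelow (β × ℕ) n).filter fun w => decide (R x w)).length
  have hrank : Primrec₂ rank :=
    (Primrec.list_length.comp (Primrec.list_filter (R := fun q w => R q.1 w)
      (primrec_elementsBelow.comp Primrec.snd)
      (hR.comp (Primrec.fst.comp Primrec.fst) Primrec.snd))).to₂
  let g : ((A × ℕ) × List Bool) × ℕ → ℕ → Option (List Bool) := fun q n =>
    (decode₂ (β × ℕ) n).bind fun w =>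
      if R q.1 w ∧ rank q.1 n = q.2 then some (F w.1) else none
  have hg' : Primrec₂ fun (q : (((A × ℕ) × List Bool) × ℕ) × ℕ) (w : β × ℕ) =>
      if R q.1.1 w ∧ rank q.1.1 q.2 = q.1.2 then some (F w.1) else none := by
    have h1 : PrimrecPred fun v : ((((A × ℕ) × List Bool) × ℕ) × ℕ) × (β × ℕ) =>
        R v.1.1.1 v.2 := hR.comp (Primrec.fst.comp (Primrec.fst.comp Primrec.fst)) Primrec.snd
    have h2 : PrimrecPred fun v : ((((A × ℕ) × List Bool) × ℕ) × ℕ) × (β × ℕ) =>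
        rank v.1.1.1 v.1.2 = v.1.1.2 :=
      Primrec.eq.comp (hrank.comp (Primrec.fst.comp (Primrec.fst.comp Primrec.fst))
        (Primrec.snd.comp Primrec.fst)) (Primrec.snd.comp (Primrec.fst.comp Primrec.fst))
    exact Primrec.ite (h1.and h2)
      (Primrec.option_some.comp (hF.comp (Primrec.fst.comp Primrec.snd))) (Primrec.const none)
  have hg : Primrec₂ g := Primrec.option_bind (Primrec.decode₂.comp Primrec.snd) hg'
  -- The rank is padded to exactly `m` bits, so the length of the string supplies `m`; only `a` has
  -- to be paid for.
  let h : (ℕ × List Bool) × List Bool → ℕ → Option (List Bool) := fun q n =>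
    (decode q.1.1 : Option A).bind fun a => g (((a, q.1.2.length), q.2), bitsValue q.1.2) n
  have hh : Primrec₂ h := by
    have hr : Primrec fun q : (((ℕ × List Bool) × List Bool) × ℕ) × A => q.1.1.1.2 :=
      Primrec.snd.comp (Primrec.fst.comp (Primrec.fst.comp Primrec.fst))
    have h1 : Primrec₂ fun (q : ((ℕ × List Bool) × List Bool) × ℕ) (a : A) =>
        g (((a, q.1.1.2.length), q.1.2), bitsValue q.1.1.2) q.2 :=
      hg.comp (((Primrec.snd.pair (Primrec.list_length.comp hr)).pair
        (Primrec.snd.comp (Primrec.fst.comp Primrec.fst))).pair (primrec_bitsValue.comp hr))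
        (Primrec.snd.comp Primrec.fst)
    exact Primrec.option_bind (Primrec.decode.comp
      (Primrec.fst.comp (Primrec.fst.comp Primrec.fst))) h1
  obtain ⟨c, hc⟩ := hU.exists_condComplexity_le (Partrec.rfindOpt hh.to_comp)
  refine ⟨c, fun a m z S hS hm b t hbt => ?_⟩
  obtain ⟨s, ⟨hs, hs'⟩⟩ : ∃ s, R ((a, m), z) (b, s) :=
    ⟨Nat.find ⟨t, hbt⟩, Nat.find_spec (p := fun t => D ((a, m), z) (b, t)) ⟨t, hbt⟩,
      fun t' ht' => Nat.find_min (p := fun t => D ((a, m), z) (b, t)) ⟨t, hbt⟩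
        (List.mem_range.1 ht')⟩
  have huniq : ∀ v w : β × ℕ, R ((a, m), z) v → R ((a, m), z) w → v.1 = w.1 → v = w := by
    rintro ⟨v, i⟩ ⟨w, j⟩ hv hw rfl
    rcases lt_trichotomy i j with hij | hij | hij
    · exact absurd hv.1 (hw.2 i (List.mem_range.2 hij))
    · rw [hij]
    · exact absurd hw.1 (hv.2 j (List.mem_range.2 hij))
  set n := encode (b, s) with hn
  have hrank_lt : ∀ v w : β × ℕ, R ((a, m), z) v → encode v < encode w →
      rank ((a, m), z) (encode v) < rank ((a, m), z) (encode w) := by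
    intro v w hv hvw
    have hnd := ((nodup_elementsBelow (α := β × ℕ) (encode v)).filter
      fun w => decide (R ((a, m), z) w))
    have hsub : v :: (elementsBelow (β × ℕ) (encode v)).filter (fun w => decide (R ((a, m), z) w)) ⊆
        (elementsBelow (β × ℕ) (encode w)).filter (fun w => decide (R ((a, m), z) w)) := by
      intro u hu
      rcases List.mem_cons.1 hu with rfl | hu
      · simpa [mem_elementsBelow, hv] using hvw
      · simp only [List.mem_filter, mem_elementsBelow] at hu ⊢
        exact ⟨hu.1.trans hvw, hu.2⟩
    have := (List.Nodup.subperm (List.nodup_cons.2 ⟨by simp [mem_elementsBelow], hnd⟩)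
      hsub).length_le
    simp only [List.length_cons] at this
    exact this
  -- The inequality is strict because `b` lies in `S` but is not counted in its own rank.
  have hlt : rank ((a, m), z) n < 2 ^ m := by
    refine lt_of_lt_of_le ?_ hm
    have hnd := ((nodup_elementsBelow (α := β × ℕ) n).filter fun w => decide (R ((a, m), z) w))
    have hcard : rank ((a, m), z) n =
        (((elementsBelow (β × ℕ) n).filter fun w => decide (R ((a, m), z) w)).toFinset.image
          Prod.fst).card := by
      rw [Finset.card_image_of_injOn, List.toFinset_card_of_nodup hnd]
      intro v hv w hw hvw
      simp only [List.coe_toFinset, Set.mem_ofPred_eq, List.mem_filter, decide_eq_true_eq] at hv hw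
      exact huniq v w hv.2 hw.2 hvw
    rw [hcard]
    refine Finset.card_lt_card ⟨?_, fun hsub => ?_⟩
    · intro v hv
      obtain ⟨w, hw, rfl⟩ := Finset.mem_image.1 hv
      simp only [List.mem_toFinset, List.mem_filter, decide_eq_true_eq] at hw
      exact hS w.1 w.2 hw.2.1
    · obtain ⟨w, hw, hwb⟩ := Finset.mem_image.1 (hsub (hS b s hs))
      simp only [List.mem_toFinset, List.mem_filter, decide_eq_true_eq, mem_elementsBelow] at hw
      rw [huniq w (b, s) hw.2 ⟨hs, hs'⟩ hwb] at hw
      exact lt_irrefl _ hw.1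
  obtain ⟨r, hr, hv⟩ := exists_bitsValue_eq m _ hlt
  have hgn : ∀ {n' x}, x ∈ h ((encode a, r), z) n' ↔ ∃ w, encode w = n' ∧
      R ((a, m), z) w ∧ rank ((a, m), z) n' = rank ((a, m), z) n ∧ F w.1 = x := by
    intro n' x
    simp only [h, g, hr, hv, encodek, Option.bind_some, Option.mem_def, Option.bind_eq_some_iff,
      decode₂_eq_some]
    refine exists_congr fun w => and_congr_right fun _ => ?_
    split_ifs with hw
    · simp [hw]
    · simp only [false_iff]
      exact fun hw' => hw ⟨hw'.1, hw'.2.1⟩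
  have key : F b ∈ Nat.rfindOpt (h ((encode a, r), z)) := by
    have hdom : (Nat.rfindOpt (h ((encode a, r), z))).Dom :=
      Nat.rfindOpt_dom.2 ⟨n, F b, hgn.2 ⟨(b, s), rfl, ⟨hs, hs'⟩, rfl, rfl⟩⟩
    obtain ⟨n', hn'⟩ := Nat.rfindOpt_spec (Part.get_mem hdom)
    obtain ⟨w, rfl, hw, hrk, hF'⟩ := hgn.1 hn'
    -- Ranks strictly increase along the enumeration, so the search can stop only at `(b, s)`.
    have hwb : w = (b, s) := by
      apply encode_injective
      rcases lt_trichotomy (encode w) (encode (b, s)) with hlt' | heq | hlt'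
      · exact absurd hrk (hrank_lt w (b, s) hw hlt').ne
      · exact heq
      · exact absurd hrk (hrank_lt (b, s) w ⟨hs, hs'⟩ hlt').ne'
    rw [hwb] at hF'
    simp only at hF'
    rw [hF']
    exact Part.get_mem hdom
  have := hc (encode a) r z (F b) key
  rwa [hr] at this

end Enumeration

/-! ### Sets of tuples with prescribed sizes of projections and sections -/

/-- The number of elements of a list with the given value of `f`. -/
def fiberLength {α : Type*} (f : α → List Bool) (l : List α) (v : List Bool) : ℕ :=
  (l.filter fun y => decide (f y = v)).length

theorem fiberLength_eq_card {α : Type*} [DecidableEq α] (f : α → List Bool) {l : List α}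
    (hl : l.Nodup)
    (v : List Bool) : fiberLength f l v = (l.toFinset.filter fun y => f y = v).card := by
  rw [fiberLength, ← List.toFinset_card_of_nodup (hl.filter _), List.toFinset_filter]
  simp

theorem IsOptimal.exists_finset_of_injective {U : DescriptionMethod} (hU : IsOptimal U) {α : Type*}
    {f : α → List Bool}
    (hf : Function.Injective f) (z : List Bool) (l : ℕ) :
    ∃ S : Finset α, S.card < 2 ^ l ∧ ∀ y, condComplexity U (f y) z < l → y ∈ S := by
  classical
  obtain ⟨S, hS, h⟩ := hU.exists_finset_condComplexity_lt z l
  refine ⟨S.preimage f hf.injOn, ?_, fun y hy => Finset.mem_preimage.2 (h _ hy)⟩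
  rw [Finset.card_preimage]
  exact (Finset.card_filter_le _ _).trans_lt hS

section Projections

variable {U : DescriptionMethod} {α : Type*} [Primcodable α] {K : ℕ} {π : Fin K → α → List Bool}

/-- `D` is a recursive approximation of the predicate `C(x | z) ≤ l`. -/
structure IsStagePredicate (U : DescriptionMethod)
    (D : (ℕ × List Bool) × List Bool → ℕ → Prop) : Prop where
  primrec : PrimrecRel D
  mono : ∀ q s t, s ≤ t → D q s → D q t
  condComplexity_le_iff : ∀ l x z, condComplexity U x z ≤ l ↔ ∃ t, D ((l, z), x) t

theorem Primrec.fin_apply (j : Fin K) : Primrec fun k : Fin K → ℕ => k j :=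
  Primrec.fin_app.comp Primrec.id (Primrec.const j)

open Classical in
/-- The objects whose projections are recognized at stage `t` as having complexity at most `k`
conditional to `z`. -/
noncomputable def stageList (D : (ℕ × List Bool) × List Bool → ℕ → Prop)
    (π : Fin K → α → List Bool) (q : (Fin K → ℕ) × List Bool) (t : ℕ) : List α :=
  (elementsBelow α t).filter fun y => decide (∀ j, D ((q.1 j, q.2), π j y) t)

theorem primrec_fiberLength {f : α → List Bool} (hf : Primrec f) : Primrec₂ (fiberLength f) := by
  have h : PrimrecRel fun (q : List α × List Bool) (y : α) => f y = q.2 :=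
    Primrec.eq.comp (hf.comp Primrec.snd) (Primrec.snd.comp Primrec.fst)
  exact Primrec.list_length.comp (Primrec.list_filter Primrec.fst h)

variable {D : (ℕ × List Bool) × List Bool → ℕ → Prop}

theorem mem_stageList {q : (Fin K → ℕ) × List Bool} {t : ℕ} {y : α} :
    y ∈ stageList D π q t ↔ encode y < t ∧ ∀ j, D ((q.1 j, q.2), π j y) t := by
  simp [stageList, mem_elementsBelow]

theorem nodup_stageList (q : (Fin K → ℕ) × List Bool) (t : ℕ) :
    (stageList D π q t).Nodup :=
  (nodup_elementsBelow t).filter _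

theorem IsStagePredicate.primrec_stageList (hD : IsStagePredicate U D)
    (hπ : ∀ j, Primrec (π j)) : Primrec₂ (stageList D π) := by
  classical
  have h : PrimrecRel fun (q : ((Fin K → ℕ) × List Bool) × ℕ) (y : α) =>
      ∀ j, D ((q.1.1 j, q.1.2), π j y) q.2 := by
    refine PrimrecPred.forall_fin fun j => ?_
    have h1 : Primrec fun q : (((Fin K → ℕ) × List Bool) × ℕ) × α => q.1.1.1 j :=
      (Primrec.fin_apply j).comp (Primrec.fst.comp (Primrec.fst.comp Primrec.fst))
    exact hD.primrec.comp ((h1.pair (Primrec.snd.comp (Primrec.fst.comp Primrec.fst))).pair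
      ((hπ j).comp Primrec.snd)) (Primrec.snd.comp Primrec.fst)
  exact (Primrec.list_filter (primrec_elementsBelow.comp Primrec.snd) h).of_eq fun q => by
    simp [stageList]

theorem IsStagePredicate.stageList_mono (hD : IsStagePredicate U D)
    {q : (Fin K → ℕ) × List Bool} {s t : ℕ} (hst : s ≤ t) {y : α}
    (hy : y ∈ stageList D π q s) : y ∈ stageList D π q t := by
  rw [mem_stageList] at hy ⊢
  exact ⟨hy.1.trans_le hst, fun j => hD.mono _ _ _ hst (hy.2 j)⟩

theorem IsStagePredicate.exists_mem_stageList_iff (hD : IsStagePredicate U D)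
    {q : (Fin K → ℕ) × List Bool} {y : α} :
    (∃ t, y ∈ stageList D π q t) ↔ ∀ j, condComplexity U (π j y) q.2 ≤ q.1 j := by
  constructor
  · rintro ⟨t, ht⟩ j
    exact (hD.condComplexity_le_iff _ _ _).2 ⟨t, (mem_stageList.1 ht).2 j⟩
  · intro h
    choose t ht using fun j => (hD.condComplexity_le_iff _ _ _).1 (h j)
    refine ⟨max (encode y + 1) (Finset.univ.sup t), mem_stageList.2 ⟨by omega, fun j => ?_⟩⟩
    exact hD.mono _ _ _ ((Finset.le_sup (Finset.mem_univ j)).trans (le_max_right _ _)) (ht j)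

theorem IsStagePredicate.exists_finset_stageList (hD : IsStagePredicate U D) (hU : IsOptimal U)
    {top : Fin K} (hinj : Function.Injective (π top)) (q : (Fin K → ℕ) × List Bool) :
    ∃ S : Finset α, S.card ≤ 2 ^ (q.1 top + 1) ∧ ∀ t, ∀ y ∈ stageList D π q t, y ∈ S := by
  obtain ⟨S, hS, h⟩ := hU.exists_finset_of_injective hinj q.2 (q.1 top + 1)
  exact ⟨S, hS.le, fun t y hy =>
    h y (Nat.lt_succ_of_le (hD.exists_mem_stageList_iff.1 ⟨t, hy⟩ top))⟩

/-- Strings that have too many preimages under a projection are simple. -/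
theorem IsStagePredicate.exists_condComplexity_le_of_fiber (hD : IsStagePredicate U D)
    (hU : IsOptimal U) (hπ : ∀ j, Primrec (π j)) {top : Fin K}
    (hinj : Function.Injective (π top)) (j : Fin K) :
    ∃ c, ∀ k z m v t, 2 ^ (k top + 1) < fiberLength (π j) (stageList D π (k, z) t) v * 2 ^ m →
      condComplexity U v z ≤ m + 2 * codeSize k + c := by
  classical
  let D' : ((Fin K → ℕ) × ℕ) × List Bool → List Bool × ℕ → Prop := fun x w =>
    2 ^ (x.1.1 top + 1) < fiberLength (π j) (stageList D π (x.1.1, x.2) w.2) w.1 * 2 ^ x.1.2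
  have hD' : PrimrecRel D' := by
    have hk : Primrec fun q : (((Fin K → ℕ) × ℕ) × List Bool) × (List Bool × ℕ) => q.1.1.1 :=
      Primrec.fst.comp (Primrec.fst.comp Primrec.fst)
    have h1 := Primrec.two_pow (Primrec.succ.comp ((Primrec.fin_apply top).comp hk))
    have h2 : Primrec fun q : (((Fin K → ℕ) × ℕ) × List Bool) × (List Bool × ℕ) => 2 ^ q.1.1.2 :=
      Primrec.two_pow (Primrec.snd.comp (Primrec.fst.comp Primrec.fst))
    have h3 : Primrec fun q : (((Fin K → ℕ) × ℕ) × List Bool) × (List Bool × ℕ) =>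
        stageList D π (q.1.1.1, q.1.2) q.2.2 :=
      (hD.primrec_stageList hπ).comp (hk.pair (Primrec.snd.comp Primrec.fst))
        (Primrec.snd.comp Primrec.snd)
    have h4 := (primrec_fiberLength (hπ j)).comp h3 (Primrec.fst.comp Primrec.snd)
    exact Primrec.nat_lt.comp h1 (Primrec.nat_mul.comp h4 h2)
  obtain ⟨c, hc⟩ := hU.exists_condComplexity_le_of_card hD' Primrec.id
  refine ⟨c, fun k z m v t h => ?_⟩
  obtain ⟨S, hS, hmem⟩ := hD.exists_finset_stageList hU hinj (k, z)
  have hle : ∀ t v, fiberLength (π j) (stageList D π (k, z) t) v ≤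
      (S.filter fun y => π j y = v).card := by
    intro t v
    rw [fiberLength_eq_card _ (nodup_stageList _ _)]
    refine Finset.card_le_card fun y hy => ?_
    simp only [Finset.mem_filter, List.mem_toFinset] at hy ⊢
    exact ⟨hmem _ _ hy.1, hy.2⟩
  refine hc k m z ((S.image (π j)).filter fun v =>
    2 ^ (k top + 1) < (S.filter fun y => π j y = v).card * 2 ^ m) ?_ ?_ v t h
  · intro v t h
    have hlt := lt_of_lt_of_le h (Nat.mul_le_mul_right _ (hle t v))
    refine Finset.mem_filter.2 ⟨?_, hlt⟩
    have hpos : 0 < (S.filter fun y => π j y = v).card := by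
      rcases Nat.eq_zero_or_pos (S.filter fun y => π j y = v).card with h0 | h0
      · rw [h0] at hlt
        simp at hlt
      · exact h0
    obtain ⟨y, hy⟩ := Finset.card_pos.1 hpos
    rw [Finset.mem_filter] at hy
    exact Finset.mem_image.2 ⟨y, hy.1, hy.2⟩
  · set B := (S.image (π j)).filter fun v =>
      2 ^ (k top + 1) < (S.filter fun y => π j y = v).card * 2 ^ m
    -- Double counting: the sections over the heavy values are disjoint subsets of `S`, each with
    -- more than `2 ^ (k top + 1) / 2 ^ m` elements.
    have h1 : B.card * 2 ^ (k top + 1) ≤ ∑ v ∈ B, (S.filter fun y => π j y = v).card * 2 ^ m := by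
      rw [← smul_eq_mul]
      exact Finset.card_nsmul_le_sum _ _ _ fun v hv => (Finset.mem_filter.1 hv).2.le
    have h2 : ∑ v ∈ B, (S.filter fun y => π j y = v).card ≤ S.card := by
      rw [← Finset.card_biUnion]
      · exact Finset.card_le_card (Finset.biUnion_subset.2 fun v _ => Finset.filter_subset _ _)
      · intro v _ w _ hvw
        exact Finset.disjoint_filter.2 fun y _ hv hw => hvw (hv.symm.trans hw)
    rw [← Finset.sum_mul] at h1
    have h3 := h1.trans (Nat.mul_le_mul_right (2 ^ m) (h2.trans hS))
    rw [mul_comm] at h3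
    exact Nat.le_of_mul_le_mul_left h3 (by positivity)

theorem IsStagePredicate.primrecRel_typical (hD : IsStagePredicate U D)
    (hπ : ∀ j, Primrec (π j)) (top : Fin K) :
    PrimrecRel fun (q : (((Fin K → ℕ) × ℕ) × ℕ) × List Bool) (w : α × ℕ) =>
      w.1 ∈ stageList D π (q.1.1.1, q.2) w.2 ∧ ∀ j,
        fiberLength (π j) (stageList D π (q.1.1.1, q.2) w.2) (π j w.1) *
          2 ^ (q.1.1.1 j - q.1.1.2) ≤ 2 ^ (q.1.1.1 top + 1) := by
  have hk : Primrec fun q : ((((Fin K → ℕ) × ℕ) × ℕ) × List Bool) × (α × ℕ) => q.1.1.1.1 :=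
    Primrec.fst.comp (Primrec.fst.comp (Primrec.fst.comp Primrec.fst))
  have hd : Primrec fun q : ((((Fin K → ℕ) × ℕ) × ℕ) × List Bool) × (α × ℕ) => q.1.1.1.2 :=
    Primrec.snd.comp (Primrec.fst.comp (Primrec.fst.comp Primrec.fst))
  have hy : Primrec fun q : ((((Fin K → ℕ) × ℕ) × ℕ) × List Bool) × (α × ℕ) => q.2.1 :=
    Primrec.fst.comp Primrec.snd
  have hl : Primrec fun q : ((((Fin K → ℕ) × ℕ) × ℕ) × List Bool) × (α × ℕ) =>
      stageList D π (q.1.1.1.1, q.1.2) q.2.2 :=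
    (hD.primrec_stageList hπ).comp (hk.pair (Primrec.snd.comp Primrec.fst))
      (Primrec.snd.comp Primrec.snd)
  refine PrimrecPred.and (PrimrecRel.list_mem.comp hy hl) (PrimrecPred.forall_fin fun j => ?_)
  have h1 : Primrec fun q : ((((Fin K → ℕ) × ℕ) × ℕ) × List Bool) × (α × ℕ) =>
      fiberLength (π j) (stageList D π (q.1.1.1.1, q.1.2) q.2.2) (π j q.2.1) :=
    (primrec_fiberLength (hπ j)).comp hl ((hπ j).comp hy)
  have h2 := Primrec.two_pow (Primrec.nat_sub.comp ((Primrec.fin_apply j).comp hk) hd)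
  have h3 := Primrec.two_pow (Primrec.succ.comp ((Primrec.fin_apply top).comp hk))
  exact Primrec.nat_le.comp (Primrec.nat_mul.comp h1 h2) h3

/-- The objects with the same complexities of projections as `x`, conditional to `z`, contain a
large subset whose projections and sections have sizes controlled by these complexities. -/
theorem IsOptimal.exists_typical_finset (hU : IsOptimal U) [DecidableEq α]
    (hπ : ∀ j, Primrec (π j)) {top : Fin K} (hinj : Function.Injective (π top)) :
    ∃ A, ∀ (x : α) (z : List Bool) (k : Fin K → ℕ), (∀ j, k j = condComplexity U (π j x) z) →
      ∃ d e, d ≤ A * (codeSize k + 1) ∧ e ≤ A * (codeSize k + 1) ∧ ∃ T : Finset α,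
        2 ^ (k top - e) ≤ T.card ∧ (∀ j, (T.image (π j)).card ≤ 2 ^ (k j + 1)) ∧
        ∀ j v, (T.filter fun y => π j y = v).card * 2 ^ (k j - d) ≤ 2 ^ (k top + 1) := by
  classical
  obtain ⟨D, h1, h2, h3⟩ := hU.exists_stage
  have hD : IsStagePredicate U D := ⟨h1, h2, h3⟩
  choose c₁ hc₁ using fun j => hD.exists_condComplexity_le_of_fiber hU hπ hinj j
  let P : (((Fin K → ℕ) × ℕ) × ℕ) × List Bool → α × ℕ → Prop := fun q w =>
    w.1 ∈ stageList D π (q.1.1.1, q.2) w.2 ∧ ∀ j,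
      fiberLength (π j) (stageList D π (q.1.1.1, q.2) w.2) (π j w.1) *
        2 ^ (q.1.1.1 j - q.1.1.2) ≤ 2 ^ (q.1.1.1 top + 1)
  have hP : PrimrecRel P := hD.primrecRel_typical hπ top
  obtain ⟨c₂, hc₂⟩ := hU.exists_condComplexity_le_of_card hP (hπ top)
  let c := Finset.univ.sup c₁
  refine ⟨12 + 4 * c + c₂, fun x z k hk => ?_⟩
  set ν := codeSize k with hν
  -- The slacks `d` and `e` exceed by one the description costs in `hc₁` and `hc₂`, so that a
  -- violated size bound would give `π j x`, or `π top x`, a description shorter than its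
  -- complexity.
  obtain ⟨d, hd⟩ : ∃ d, d = 2 * ν + c + 1 := ⟨_, rfl⟩
  obtain ⟨e, he⟩ : ∃ e, e = 2 * codeSize (k, d) + c₂ + 1 := ⟨_, rfl⟩
  have hν2 : codeSize (k, d) ≤ 2 * (ν + d) :=
    (codeSize_pair_le k d).trans (by have := codeSize_nat_le d; omega)
  obtain ⟨S, hS, hmem⟩ := hD.exists_finset_stageList hU hinj (k, z)
  let T := S.filter fun y => ∃ t, ∀ m, P (((k, d), m), z) (y, t)
  have hT : ∀ {y}, y ∈ T ↔ ∃ t, ∀ m, P (((k, d), m), z) (y, t) := by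
    intro y
    refine ⟨fun h => (Finset.mem_filter.1 h).2, fun h => Finset.mem_filter.2 ⟨?_, h⟩⟩
    obtain ⟨t, ht⟩ := h
    exact hmem t y (ht 0).1
  obtain ⟨t₀, ht₀⟩ := hD.exists_mem_stageList_iff (π := π) (q := (k, z)) (y := x).2
    fun j => (hk j).ge
  have hxP : ∀ m, P (((k, d), m), z) (x, t₀) := by
    refine fun m => ⟨ht₀, fun j => ?_⟩
    by_contra! hlt
    have h1 := hc₁ j k z (k j - d) (π j x) t₀ hlt
    rw [← hk j] at h1
    have h2 : c₁ j ≤ c := Finset.le_sup (Finset.mem_univ j)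
    -- The contradiction fails only when the subtraction truncates; the section bound is then the
    -- trivial bound by the size of `S`.
    have h3 : k j - d = 0 := by omega
    simp only [h3, pow_zero, mul_one] at hlt
    rw [fiberLength_eq_card _ (nodup_stageList _ _)] at hlt
    refine absurd (Finset.card_le_card fun y hy => ?_) (not_le.2 (hS.trans_lt hlt))
    simp only [Finset.mem_filter, List.mem_toFinset] at hy
    exact hmem _ _ hy.1
  have hxT : x ∈ T := hT.2 ⟨t₀, hxP⟩
  refine ⟨d, e, ?_, ?_, T, ?_, ?_, ?_⟩
  · nlinarith
  · nlinarith
  -- If `T` were smaller, its member `x` would be too simple given `z`; in the truncated case `T`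
  -- would be empty.
  · by_contra! hlt
    have h1 := hc₂ (k, d) (k top - e) z T (fun b t hb => hT.2 ⟨t, fun _ => hb⟩) hlt.le x t₀ (hxP _)
    rw [← hk top] at h1
    have h2 : k top - e = 0 := by omega
    rw [h2] at hlt
    have := Finset.card_pos.2 ⟨x, hxT⟩
    omega
  · intro j
    obtain ⟨B, hB, hBmem⟩ := hU.exists_finset_condComplexity_lt z (k j + 1)
    refine (Finset.card_le_card fun v hv => ?_).trans hB.le
    obtain ⟨y, hy, rfl⟩ := Finset.mem_image.1 hv
    obtain ⟨t, ht⟩ := hT.1 hy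
    exact hBmem _ (Nat.lt_succ_of_le (hD.exists_mem_stageList_iff.1 ⟨t, (ht 0).1⟩ j))
  · intro j v
    rcases (T.filter fun y => π j y = v).eq_empty_or_nonempty with h0 | h0
    · rw [h0]
      simp
    -- Membership in `T` tests sections only at some finite stage. The member of a section with the
    -- latest stage controls the whole section, since all other members are already listed by then.
    · choose! τ hτ using fun y (hy : y ∈ T) => hT.1 hy
      obtain ⟨y, hy, hmax⟩ := Finset.exists_max_image _ τ h0
      rw [Finset.mem_filter] at hy
      refine le_trans (Nat.mul_le_mul_right _ ?_) ((hτ y hy.1 0).2 j)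
      rw [fiberLength_eq_card _ (nodup_stageList _ _)]
      refine Finset.card_le_card fun w hw => ?_
      have hw' := Finset.mem_filter.1 hw
      refine Finset.mem_filter.2 ⟨List.mem_toFinset.2 ?_, hw'.2.trans hy.2.symm⟩
      exact hD.stageList_mono (hmax w hw) (hτ w hw'.1 0).1

end Projections

/-! ### Finite models -/

section IsModel

variable {α : Type*} {K : ℕ} {π : Fin K → α → List Bool}

open Classical in
/-- `w` consists of a set of objects with given bounds for its size and for the sizes of its
sections, and of lists containing its projections. -/
def IsModel (π : Fin K → α → List Bool) (top : Fin K) (q : ((Fin K → ℕ) × ℕ) × ℕ)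
    (w : List α × (Fin K → List (List Bool))) : Prop :=
  (∀ y ∈ w.1, (w.1.filter fun y' => decide (y' = y)).length ≤ 1) ∧
    2 ^ (q.1.1 top - q.2) ≤ w.1.length ∧
    ∀ j, (w.2 j).length ≤ 2 ^ (q.1.1 j + 1) ∧ (∀ y ∈ w.1, π j y ∈ w.2 j) ∧
      ∀ v ∈ w.2 j, fiberLength (π j) w.1 v * 2 ^ (q.1.1 j - q.1.2) ≤ 2 ^ (q.1.1 top + 1)

/-- Absence of repetitions is expressed through lengths of filtered lists because this form is
visibly primitive recursive. -/
theorem IsModel.nodup {top : Fin K} {q : ((Fin K → ℕ) × ℕ) × ℕ}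
    {w : List α × (Fin K → List (List Bool))} (h : IsModel π top q w) : w.1.Nodup := by
  classical
  rw [List.nodup_iff_count_le_one]
  intro y
  by_cases hy : y ∈ w.1
  · have := h.1 y hy
    rw [List.count_eq_length_filter]
    convert this using 3
    funext y'
    simp [Bool.beq_eq_decide_eq]
  · simp [List.count_eq_zero_of_not_mem hy]

/-- Here the condition disappears: `IsModel` is a decidable property of finite lists that refers
neither to `z` nor to complexity. -/
theorem exists_isModel [DecidableEq α] {top : Fin K} {k : Fin K → ℕ} {d e : ℕ} {T : Finset α}
    (h1 : 2 ^ (k top - e) ≤ T.card) (h2 : ∀ j, (T.image (π j)).card ≤ 2 ^ (k j + 1))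
    (h3 : ∀ j v, (T.filter fun y => π j y = v).card * 2 ^ (k j - d) ≤ 2 ^ (k top + 1)) :
    ∃ w, IsModel π top ((k, d), e) w := by
  refine ⟨(T.toList, fun j => (T.image (π j)).toList), fun y hy => ?_, by simpa using h1,
    fun j => ⟨by simpa using h2 j, fun y hy => ?_, fun v _ => ?_⟩⟩
  · have := List.nodup_iff_count_le_one.1 T.nodup_toList y
    rw [List.count_eq_length_filter] at this
    convert this using 3
    funext y'
    simp [Bool.beq_eq_decide_eq]
  · rw [Finset.mem_toList] at hy ⊢
    exact Finset.mem_image_of_mem _ hy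
  · rw [fiberLength_eq_card _ T.nodup_toList, Finset.toList_toFinset]
    exact h3 j v

end IsModel

section Models

variable {U : DescriptionMethod} {α : Type*} [Primcodable α] {K : ℕ} {π : Fin K → α → List Bool}

/-- Taking the solution of least code makes it a function of the parameters, so a model costs no
more to describe than its parameters. -/
theorem PrimrecRel.exists_uniformization {Q W : Type*} [Primcodable Q] [Primcodable W]
    {R : Q → W → Prop} (hR : PrimrecRel R) :
    ∃ G : Q → W → Prop, PrimrecRel G ∧ (∀ q w, G q w → R q w) ∧
      (∀ q w w', G q w → G q w' → w = w') ∧ ∀ q w, R q w → ∃ w', G q w' := by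
  classical
  have h1 : PrimrecRel fun (q : Q × W) (w : W) => ¬ R q.1 w :=
    PrimrecPred.not (hR.comp (Primrec.fst.comp Primrec.fst) Primrec.snd)
  refine ⟨fun q w => R q w ∧ ∀ w' ∈ elementsBelow W (encode w), ¬ R q w', ?_, ?_, ?_, ?_⟩
  · exact PrimrecPred.and hR (PrimrecPred.forall_mem
      (primrec_elementsBelow.comp (Primrec.encode.comp Primrec.snd)) h1)
  · exact fun q w h => h.1
  · intro q w w' h h'
    apply encode_injective
    rcases lt_trichotomy (encode w) (encode w') with hlt | heq | hlt
    · exact absurd h.1 (h'.2 w (mem_elementsBelow.2 hlt))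
    · exact heq
    · exact absurd h'.1 (h.2 w' (mem_elementsBelow.2 hlt))
  · intro q w hw
    have hex : ∃ n, ∃ w, encode w = n ∧ R q w := ⟨_, w, rfl, hw⟩
    obtain ⟨w', hw', hR'⟩ := Nat.find_spec hex
    refine ⟨w', hR', fun v hv hRv => ?_⟩
    rw [mem_elementsBelow, hw'] at hv
    exact Nat.find_min hex hv ⟨v, rfl, hRv⟩

theorem encode_finArrow {β : Type*} [Primcodable β] (k : Fin K → β) :
    @encode _ Primcodable.finArrow.toEncodable k = encode (List.ofFn k) := by
  change encode (List.Vector.ofFn k).toList = _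
  rw [List.Vector.toList_ofFn]

theorem le_encode_of_mem {l : List ℕ} {a : ℕ} (h : a ∈ l) : a ≤ encode l := by
  induction l with
  | nil => simp at h
  | cons b l ih =>
    rw [encode_list_cons]
    rcases List.mem_cons.1 h with rfl | h
    · exact (Nat.left_le_pair _ _).trans (Nat.le_succ _)
    · exact (ih h).trans ((Nat.right_le_pair _ _).trans (Nat.le_succ _))

theorem codeSize_apply_le (k : Fin K → ℕ) (j : Fin K) : codeSize (k j) ≤ codeSize k := by
  refine Nat.size_le_size ?_
  rw [encode_finArrow]
  exact le_encode_of_mem (by simp)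

theorem codeSize_le_codeSize_pair {β γ : Type*} [Primcodable β] [Primcodable γ] (a : β) (b : γ) :
    codeSize a ≤ codeSize (a, b) :=
  Nat.size_le_size (Nat.left_le_pair _ _)

theorem primrecRel_isModel (hπ : ∀ j, Primrec (π j)) (top : Fin K) :
    PrimrecRel (IsModel π top) := by
  classical
  have hk : Primrec fun p : (((Fin K → ℕ) × ℕ) × ℕ) × (List α × (Fin K → List (List Bool))) =>
      p.1.1.1 := Primrec.fst.comp (Primrec.fst.comp Primrec.fst)
  have hd : Primrec fun p : (((Fin K → ℕ) × ℕ) × ℕ) × (List α × (Fin K → List (List Bool))) =>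
      p.1.1.2 := Primrec.snd.comp (Primrec.fst.comp Primrec.fst)
  have he : Primrec fun p : (((Fin K → ℕ) × ℕ) × ℕ) × (List α × (Fin K → List (List Bool))) =>
      p.1.2 := Primrec.snd.comp Primrec.fst
  have hL : Primrec fun p : (((Fin K → ℕ) × ℕ) × ℕ) × (List α × (Fin K → List (List Bool))) =>
      p.2.1 := Primrec.fst.comp Primrec.snd
  have hM (j : Fin K) :
      Primrec fun p : (((Fin K → ℕ) × ℕ) × ℕ) × (List α × (Fin K → List (List Bool))) =>
      p.2.2 j := Primrec.fin_app.comp (Primrec.snd.comp Primrec.snd) (Primrec.const j)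
  have hkj (j : Fin K) := (Primrec.fin_apply j).comp hk
  refine PrimrecPred.and ?_ (PrimrecPred.and ?_ (PrimrecPred.forall_fin fun j =>
    PrimrecPred.and ?_ (PrimrecPred.and ?_ ?_)))
  · refine PrimrecPred.forall_mem hL ?_
    have h1 : PrimrecRel fun (p : ((((Fin K → ℕ) × ℕ) × ℕ) ×
        (List α × (Fin K → List (List Bool)))) × α) (y : α) => y = p.2 :=
      Primrec.eq.comp Primrec.snd (Primrec.snd.comp Primrec.fst)
    exact Primrec.nat_le.comp (Primrec.list_length.comp
      (Primrec.list_filter (hL.comp Primrec.fst) h1)) (Primrec.const 1)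
  · exact Primrec.nat_le.comp (Primrec.two_pow (Primrec.nat_sub.comp (hkj top) he))
      (Primrec.list_length.comp hL)
  · exact Primrec.nat_le.comp (Primrec.list_length.comp (hM j))
      (Primrec.two_pow (Primrec.succ.comp (hkj j)))
  · refine PrimrecPred.forall_mem hL ?_
    exact PrimrecRel.list_mem.comp ((hπ j).comp Primrec.snd) ((hM j).comp Primrec.fst)
  · refine PrimrecPred.forall_mem (hM j) ?_
    have h1 : Primrec fun p : ((((Fin K → ℕ) × ℕ) × ℕ) ×
        (List α × (Fin K → List (List Bool)))) × List Bool => fiberLength (π j) p.1.2.1 p.2 :=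
      (primrec_fiberLength (hπ j)).comp (hL.comp Primrec.fst) Primrec.snd
    have h2 := Primrec.two_pow (Primrec.nat_sub.comp (hkj j) hd)
    have h3 := Primrec.two_pow (Primrec.succ.comp (hkj top))
    exact Primrec.nat_le.comp (Primrec.nat_mul.comp h1 (h2.comp Primrec.fst))
      (h3.comp Primrec.fst)

/-- A set of objects with given sizes of projections and sections contains an object whose
projections have the corresponding complexities. -/
theorem IsOptimal.exists_complexity_of_isModel (hU : IsOptimal U) (hπ : ∀ j, Primrec (π j))
    {top : Fin K} (hinj : Function.Injective (π top)) :
    ∃ A, ∀ (k : Fin K → ℕ) (d e : ℕ), (∃ w, IsModel π top ((k, d), e) w) →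
      ∃ x : α, ∀ j, complexity U (π j x) ≤ k j + A * (codeSize ((k, d), e) + 1) ∧
        k j ≤ complexity U (π j x) + d + e + A * (codeSize ((k, d), e) + 1) := by
  classical
  obtain ⟨G, hG, hGR, huniq, hGex⟩ := (primrecRel_isModel hπ top).exists_uniformization
  obtain ⟨D, hD, hDmono, hDU⟩ := hU.exists_stage
  -- `P₁` enumerates the listed projections of the selected model, for the upper bounds; `P₂`
  -- enumerates its members whose `j`-th projection has complexity at most a given number, for the
  -- lower bounds.
  let P₁ (j : Fin K) : ((((Fin K → ℕ) × ℕ) × ℕ) × ℕ) × List Bool → List Bool × ℕ → Prop :=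
    fun q w => ∃ m ∈ elementsBelow (List α × (Fin K → List (List Bool))) w.2,
      G q.1.1 m ∧ w.1 ∈ m.2 j
  have hP₁ (j : Fin K) : PrimrecRel (P₁ j) := by
    refine PrimrecPred.exists_mem (primrec_elementsBelow.comp (Primrec.snd.comp Primrec.snd)) ?_
    refine PrimrecPred.and (hG.comp (Primrec.fst.comp (Primrec.fst.comp (Primrec.fst.comp
      Primrec.fst))) Primrec.snd) ?_
    exact PrimrecRel.list_mem.comp (Primrec.fst.comp (Primrec.snd.comp Primrec.fst))
      (Primrec.fin_app.comp (Primrec.snd.comp Primrec.snd) (Primrec.const j))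
  let P₂ (j : Fin K) : (((((Fin K → ℕ) × ℕ) × ℕ) × ℕ) × ℕ) × List Bool → α × ℕ → Prop :=
    fun q w => D ((q.1.1.2, []), π j w.1) w.2 ∧
      ∃ m ∈ elementsBelow (List α × (Fin K → List (List Bool))) w.2, G q.1.1.1 m ∧ w.1 ∈ m.1
  have hP₂ (j : Fin K) : PrimrecRel (P₂ j) := by
    refine PrimrecPred.and (hD.comp ?_ (Primrec.snd.comp Primrec.snd)) (PrimrecPred.exists_mem
      (primrec_elementsBelow.comp (Primrec.snd.comp Primrec.snd)) (PrimrecPred.and ?_ ?_))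
    · exact ((Primrec.snd.comp (Primrec.fst.comp (Primrec.fst.comp Primrec.fst))).pair
        (Primrec.const [])).pair ((hπ j).comp (Primrec.fst.comp Primrec.snd))
    · exact hG.comp (Primrec.fst.comp (Primrec.fst.comp (Primrec.fst.comp (Primrec.fst.comp
        Primrec.fst)))) Primrec.snd
    · exact PrimrecRel.list_mem.comp (Primrec.fst.comp (Primrec.snd.comp Primrec.fst))
        (Primrec.fst.comp Primrec.snd)
  choose c₁ hc₁ using fun j => hU.exists_condComplexity_le_of_card (hP₁ j) Primrec.id
  choose c₂ hc₂ using fun j => hU.exists_condComplexity_le_of_card (hP₂ j) (hπ top)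
  refine ⟨8 + Finset.univ.sup c₁ + Finset.univ.sup c₂, fun k d e hw => ?_⟩
  obtain ⟨w₀, hw₀⟩ := hw
  obtain ⟨w, hw⟩ := hGex _ _ hw₀
  have hM := hGR _ _ hw
  obtain ⟨s, hs⟩ := exists_mem_elementsBelow w
  -- Fewer than `2 ^ (k top - e)` objects are simpler than this, and the model has at least that
  -- many members.
  obtain ⟨x, hx, hxC⟩ : ∃ x ∈ w.1, k top - e ≤ complexity U (π top x) := by
    obtain ⟨S, hS, hmem⟩ := hU.exists_finset_of_injective hinj [] (k top - e)
    by_contra! h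
    have h1 : w.1.toFinset ⊆ S := fun y hy => hmem y (h y (List.mem_toFinset.1 hy))
    have h2 := Finset.card_le_card h1
    rw [List.toFinset_card_of_nodup hM.nodup] at h2
    exact absurd (hM.2.1.trans h2) (not_le.2 hS)
  refine ⟨x, fun j => ?_⟩
  set ν := codeSize ((k, d), e) with hν
  have hc1 : c₁ j ≤ Finset.univ.sup c₁ := Finset.le_sup (Finset.mem_univ j)
  have hc2 : c₂ j ≤ Finset.univ.sup c₂ := Finset.le_sup (Finset.mem_univ j)
  have hupper : complexity U (π j x) ≤ k j + 1 + 2 * ν + c₁ j := by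
    refine hc₁ j ((k, d), e) (k j + 1) [] (w.2 j).toFinset ?_ ?_ (π j x) s ?_
    · rintro v t ⟨w', -, hw', hv⟩
      rw [huniq _ _ _ hw' hw] at hv
      exact List.mem_toFinset.2 hv
    · exact (List.toFinset_card_le _).trans (hM.2.2 j).1
    · exact ⟨w, hs s le_rfl, hw, (hM.2.2 j).2.1 x hx⟩
  refine ⟨by nlinarith, ?_⟩
  by_cases hq : k j ≤ complexity U (π j x)
  · exact hq.trans (by rw [add_assoc, add_assoc]; exact Nat.le_add_right _ _)
  push Not at hq
  obtain ⟨q, hqx⟩ : ∃ q, q = complexity U (π j x) := ⟨_, rfl⟩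
  rw [← hqx] at hq ⊢
  have hfib : ∀ v ∈ w.2 j, (w.1.toFinset.filter fun y => π j y = v).card * 2 ^ (k j - d) ≤
      2 ^ (k top + 1) := fun v hv => by
    rw [← fiberLength_eq_card _ hM.nodup]
    exact (hM.2.2 j).2.2 v hv
  -- A nonempty section forces this inequality; the difference `u` is then the logarithm of the
  -- bound on sections.
  have hle : k j - d ≤ k top + 1 := by
    have h1 : 0 < (w.1.toFinset.filter fun y => π j y = π j x).card :=
      Finset.card_pos.2 ⟨x, by simp [hx]⟩
    have h2 := hfib (π j x) ((hM.2.2 j).2.1 x hx)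
    exact (Nat.pow_le_pow_iff_right (by norm_num)).1
      ((Nat.le_mul_of_pos_left _ h1).trans h2)
  obtain ⟨u, hu⟩ := Nat.exists_eq_add_of_le hle
  -- At most `2 ^ (q + 1)` projections have complexity at most `q`, each with at most `2 ^ u`
  -- preimages. Comparison with `hxC` bounds `k j` in terms of `q`.
  have hlower : complexity U (π top x) ≤ u + (q + 1) + 2 * codeSize (((k, d), e), q) + c₂ j := by
    obtain ⟨B, hB, hBmem⟩ := hU.exists_finset_condComplexity_lt [] (q + 1)
    obtain ⟨t, ht⟩ := (hDU q (π j x) []).1 hqx.ge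
    refine hc₂ j (((k, d), e), q) (u + (q + 1)) []
      (w.1.toFinset.filter fun y => complexity U (π j y) ≤ q) ?_ ?_ x
      (max t s) ⟨hDmono _ _ _ (le_max_left _ _) ht, w, hs _ (le_max_right _ _), hw, hx⟩
    · rintro y t' ⟨hy, w', -, hw', hyw⟩
      rw [huniq _ _ _ hw' hw] at hyw
      exact Finset.mem_filter.2 ⟨List.mem_toFinset.2 hyw, (hDU _ _ _).2 ⟨_, hy⟩⟩
    · refine (Finset.card_le_mul_card_image (f := π j) _ (2 ^ u) fun v hv => ?_).trans ?_
      · obtain ⟨y, hy, rfl⟩ := Finset.mem_image.1 hv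
        have h1 := hfib (π j y)
          ((hM.2.2 j).2.1 y (List.mem_toFinset.1 (Finset.mem_filter.1 hy).1))
        rw [hu, pow_add, mul_comm] at h1
        refine (Finset.card_le_card ?_).trans (Nat.le_of_mul_le_mul_left h1 (by positivity))
        exact Finset.filter_subset_filter _ (Finset.filter_subset _ _)
      · rw [pow_add]
        refine Nat.mul_le_mul_left _ ((Finset.card_le_card fun v hv => ?_).trans hB.le)
        obtain ⟨y, hy, rfl⟩ := Finset.mem_image.1 hv
        exact hBmem _ (Nat.lt_succ_of_le (Finset.mem_filter.1 hy).2)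
  have h1 : codeSize (((k, d), e), q) ≤ 2 * (ν + codeSize q) := codeSize_pair_le _ _
  -- The remaining case `q < k j` makes the extra parameter `q` no more expensive than `k`.
  have h2 : codeSize q ≤ ν :=
    ((Nat.size_le_size hq.le).trans (codeSize_apply_le k j)).trans
      ((codeSize_le_codeSize_pair _ _).trans (codeSize_le_codeSize_pair _ _))
  have h3 : 8 * ν + 8 + Finset.univ.sup c₂ ≤
      (8 + Finset.univ.sup c₁ + Finset.univ.sup c₂) * (ν + 1) := by nlinarith
  omega

end Models

/-! ### Unconditional counterparts of conditional complexities -/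

section Transfer

variable {U : DescriptionMethod} {α : Type*} [Primcodable α] {K : ℕ} {π : Fin K → α → List Bool}

/-- For every object `x` and every condition `z` there is an object `x'` such that the
unconditional complexities of the projections of `x'` are close to the complexities of the
projections of `x` conditional to `z`. -/
theorem IsOptimal.exists_unconditional (hU : IsOptimal U) (hπ : ∀ j, Primrec (π j))
    {top : Fin K} (hinj : Function.Injective (π top)) :
    ∃ A, ∀ (x : α) (z : List Bool) (k : Fin K → ℕ), (∀ j, k j = condComplexity U (π j x) z) →
      ∃ x' : α, ∀ j, complexity U (π j x') ≤ k j + A * (codeSize k + 1) ∧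
        k j ≤ complexity U (π j x') + A * (codeSize k + 1) := by
  classical
  obtain ⟨A, hA⟩ := hU.exists_typical_finset hπ hinj
  obtain ⟨B, hB⟩ := hU.exists_complexity_of_isModel hπ hinj
  refine ⟨2 * A + B * (6 * A + 5), fun x z k hk => ?_⟩
  obtain ⟨d, e, hd, he, T, h1, h2, h3⟩ := hA x z k hk
  obtain ⟨x', hx'⟩ := hB k d e (exists_isModel h1 h2 h3)
  set ν := codeSize k
  -- Since `d` and `e` are themselves linear in `ν`, the crude bound of their code sizes by their
  -- values suffices.
  have h4 : codeSize ((k, d), e) + 1 ≤ (6 * A + 5) * (ν + 1) := by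
    have h5 := codeSize_pair_le (k, d) e
    have h6 := codeSize_pair_le k d
    have h7 := codeSize_nat_le d
    have h8 := codeSize_nat_le e
    nlinarith
  have h5 := Nat.mul_le_mul_left B h4
  refine ⟨x', fun j => ?_⟩
  obtain ⟨h6, h7⟩ := hx' j
  have h8 : (2 * A + B * (6 * A + 5)) * (ν + 1) =
      A * (ν + 1) + A * (ν + 1) + B * ((6 * A + 5) * (ν + 1)) := by ring
  rw [h8]
  constructor <;> omega

/-- Applying a computable function increases complexity at most logarithmically. -/
theorem IsOptimal.exists_condComplexity_comp_le (hU : IsOptimal U) {F G : α → List Bool}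
    (hF : Primrec F) (hG : Primrec G) (hinj : Function.Injective G) :
    ∃ c, ∀ x z, condComplexity U (F x) z ≤ 3 * condComplexity U (G x) z + c := by
  obtain ⟨D, hD, -, hDU⟩ := hU.exists_stage
  have hP : PrimrecRel fun (q : (ℕ × ℕ) × List Bool) (w : α × ℕ) =>
      D ((q.1.1, q.2), G w.1) w.2 := by
    refine hD.comp ?_ (Primrec.snd.comp Primrec.snd)
    exact ((Primrec.fst.comp (Primrec.fst.comp Primrec.fst)).pair
      (Primrec.snd.comp Primrec.fst)).pair (hG.comp (Primrec.fst.comp Primrec.snd))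
  obtain ⟨c, hc⟩ := hU.exists_condComplexity_le_of_card hP hF
  refine ⟨c + 1, fun x z => ?_⟩
  obtain ⟨l, hl⟩ : ∃ l, l = condComplexity U (G x) z := ⟨_, rfl⟩
  obtain ⟨S, hS, hmem⟩ := hU.exists_finset_of_injective hinj z (l + 1)
  obtain ⟨t, ht⟩ := (hDU l (G x) z).1 hl.ge
  have h1 := hc l (l + 1) z S
    (fun y t h => hmem y (Nat.lt_succ_of_le ((hDU _ _ _).2 ⟨t, h⟩))) hS.le x t ht
  -- This crude bound produces the factor 3, which is harmless because the result is used only under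
  -- a logarithm.
  have h2 := codeSize_nat_le l
  omega

/-- Each of the `K` nested pairings at most doubles the size, so for fixed `K` the loss is a
constant factor. -/
theorem exists_codeSize_le (K : ℕ) :
    ∃ E, ∀ (k : Fin K → ℕ) (M : ℕ), (∀ j, k j ≤ M) → codeSize k ≤ E * (Nat.size M + 1) := by
  have h : ∀ K : ℕ, ∃ E, ∀ (l : List ℕ) (M : ℕ), l.length = K → (∀ a ∈ l, a ≤ M) →
      codeSize l ≤ E * (Nat.size M + 1) := by
    intro K
    induction K with
    | zero =>
      refine ⟨0, fun l M hl _ => ?_⟩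
      rw [List.length_eq_zero_iff.1 hl]
      simp [codeSize]
    | succ K ih =>
      obtain ⟨E, hE⟩ := ih
      refine ⟨2 * E + 3, fun l M hl hM => ?_⟩
      cases l with
      | nil => simp at hl
      | cons a l =>
        have h1 := hE l M (by simpa using hl) fun b hb => hM b (List.mem_cons_of_mem _ hb)
        have h2 : codeSize a ≤ Nat.size M := Nat.size_le_size (hM a List.mem_cons_self)
        have h3 : codeSize (a, l) ≤ 2 * (codeSize a + codeSize l) := codeSize_pair_le a l
        have h4 : codeSize (a :: l) ≤ codeSize (a, l) + 1 := by
          change Nat.size (encode (a, l) + 1) ≤ Nat.size (encode (a, l)) + 1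
          rw [Nat.size_le, pow_succ]
          have := Nat.lt_size_self (encode (a, l))
          omega
        nlinarith
  obtain ⟨E, hE⟩ := h K
  refine ⟨E, fun k M hM => ?_⟩
  rw [codeSize, encode_finArrow]
  exact hE _ M (by simp) (by simpa [List.mem_ofFn] using hM)

end Transfer

/-! ### Logarithmic bounds -/

/-- A constant factor inside the logarithm becomes an additive constant, absorbed because `log (N +
2) ≥ log 2`. -/
theorem exists_log_le (c : ℕ) : ∃ B : ℝ, 0 ≤ B ∧ ∀ N v : ℕ, v ≤ c * (N + 2) →
    Real.log ((v : ℝ) + 2) ≤ B * Real.log ((N : ℝ) + 2) := by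
  have h2 : 0 < Real.log 2 := Real.log_pos (by norm_num)
  have hc : 0 ≤ Real.log ((c : ℝ) + 1) := Real.log_nonneg (by linarith [Nat.cast_nonneg (α := ℝ) c])
  refine ⟨Real.log (c + 1) / Real.log 2 + 1, by positivity, fun N v h => ?_⟩
  have hN : Real.log 2 ≤ Real.log ((N : ℝ) + 2) :=
    Real.log_le_log (by norm_num) (by linarith [Nat.cast_nonneg (α := ℝ) N])
  have h1 : (v : ℝ) + 2 ≤ (c + 1) * (N + 2) := by
    have : (v : ℝ) ≤ c * (N + 2) := by exact_mod_cast h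
    nlinarith [Nat.cast_nonneg (α := ℝ) N]
  calc Real.log ((v : ℝ) + 2) ≤ Real.log ((c + 1) * (N + 2)) := Real.log_le_log (by positivity) h1
    _ = Real.log (c + 1) + Real.log (N + 2) := Real.log_mul (by positivity) (by positivity)
    _ = Real.log (c + 1) / Real.log 2 * Real.log 2 + Real.log (N + 2) := by
      rw [div_mul_cancel₀ _ h2.ne']
    _ ≤ Real.log (c + 1) / Real.log 2 * Real.log (N + 2) + Real.log (N + 2) := by gcongr
    _ = _ := by ring

theorem size_le_log (M : ℕ) : (Nat.size M : ℝ) ≤ 2 / Real.log 2 * Real.log ((M : ℝ) + 2) := by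
  have h2 : 0 < Real.log 2 := Real.log_pos (by norm_num)
  have hM : Real.log 2 ≤ Real.log ((M : ℝ) + 2) :=
    Real.log_le_log (by norm_num) (by linarith [Nat.cast_nonneg (α := ℝ) M])
  rw [div_mul_eq_mul_div, le_div_iff₀ h2]
  rcases Nat.eq_zero_or_pos (Nat.size M) with h | h
  · rw [h]
    push_cast
    linarith
  · obtain ⟨s, hs⟩ := Nat.exists_eq_succ_of_ne_zero h.ne'
    have h1 : 2 ^ s ≤ M := Nat.lt_size.1 (by omega)
    have h3 : (2 : ℝ) ^ s ≤ (M : ℝ) + 2 := by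
      have : (2 : ℝ) ^ s ≤ M := by exact_mod_cast h1
      linarith
    have h4 := Real.log_le_log (by positivity) h3
    rw [Real.log_pow] at h4
    rw [hs]
    push_cast
    linarith

/-! ### Projections of tuples -/

theorem primrec_tupleCode : Primrec tupleCode := by
  have h : Primrec selfDelimiting := by
    have h1 : Primrec₂ fun (_ : List Bool) (b : Bool) => [true, b] :=
      Primrec.list_cons.comp (Primrec.const true)
        (Primrec.list_cons.comp Primrec.snd (Primrec.const []))
    exact Primrec.list_append.comp (Primrec.list_flatMap Primrec.id h1) (Primrec.const [false])
  exact Primrec.list_flatMap Primrec.id (h.comp Primrec.snd).to₂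

theorem primrec_tupleCode_map {n : ℕ} (l : List (Fin n)) :
    Primrec fun y : Fin n → List Bool => tupleCode (l.map y) :=
  primrec_tupleCode.comp (Primrec.list_map (Primrec.const l) Primrec.fin_app)

theorem tupleCode_map_univ_injective (n : ℕ) : Function.Injective
    fun y : Fin n → List Bool =>
      tupleCode (((Finset.univ : Finset (Fin n)).sort (· ≤ ·)).map y) := by
  intro y y' h
  funext i
  exact List.map_inj_left.1 (tupleCode_injective h) i (by simp)

theorem mainTheorem7 (U : DescriptionMethod) (hU : IsOptimal U)
    (lam : ℝ) (hlam0 : 0 < lam) (hlam1 : lam < 1)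
    (hscale : ∀ k : ℕ, ∃ c : ℝ, ∀ y : Fin k → List Bool, ∃ z : List Bool, ∀ i : Fin k,
      |(condComplexity U (y i) z : ℝ) - lam * (complexity U (y i) : ℝ)|
        ≤ c * Real.log ((tupleComplexity U y Finset.univ : ℝ) + 2)) :
    ∀ n : ℕ, ∃ c : ℝ, ∀ x : Fin n → List Bool, ∃ x' : Fin n → List Bool,
      ∀ J : Finset (Fin n), J.Nonempty →
        |(tupleComplexity U x' J : ℝ) - lam * (tupleComplexity U x J : ℝ)|
          ≤ c * Real.log ((tupleComplexity U x Finset.univ : ℝ) + 2) := by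
  intro n
  -- All index sets are numbered, so that the profile of a tuple becomes a function on `Fin K`; the
  -- full index set plays the role of `top`.
  obtain ⟨K, ⟨ε⟩⟩ := Finite.exists_equiv_fin (Finset (Fin n))
  let π : Fin K → (Fin n → List Bool) → List Bool := fun j y =>
    tupleCode (((ε.symm j).sort (· ≤ ·)).map y)
  have hπ : ∀ j, Primrec (π j) := fun j => primrec_tupleCode_map _
  have hπε : ∀ y J, complexity U (π (ε J) y) = tupleComplexity U y J := by
    intro y J
    simp only [π, Equiv.symm_apply_apply, tupleComplexity]
  have hinj : Function.Injective (π (ε Finset.univ)) := by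
    intro y y' h
    simp only [π, Equiv.symm_apply_apply] at h
    exact tupleCode_map_univ_injective n h
  -- The error in `hscale` involves the tuple of all subtuple codes; it is computable from the full
  -- tuple, so its complexity is linear in `N`.
  have hall : Primrec fun y : Fin n → List Bool =>
      tupleCode (((Finset.univ : Finset (Fin K)).sort (· ≤ ·)).map fun j => π j y) := by
    refine primrec_tupleCode.comp (Primrec.list_map (Primrec.const _) ?_)
    exact (Primrec.fin_curry₁.2 hπ).swap
  obtain ⟨A, hA⟩ := hU.exists_unconditional hπ hinj
  obtain ⟨c₀, hc₀⟩ := hU.exists_condComplexity_comp_le hall (hπ _) hinj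
  choose c₁ hc₁ using fun j => hU.exists_condComplexity_comp_le (hπ j) (hπ _) hinj
  obtain ⟨E, hE⟩ := exists_codeSize_le K
  obtain ⟨c, hc⟩ := hscale K
  obtain ⟨B, hB0, hB⟩ := exists_log_le (3 + c₀)
  -- A natural number above `|c| * B` turns the scaling error into a summand of an integer bound on
  -- `k j`, by means of `log t ≤ t - 1`.
  obtain ⟨m, hm⟩ : ∃ m : ℕ, |c| * B ≤ m := exists_nat_ge _
  obtain ⟨B', hB'0, hB'⟩ := exists_log_le (3 + Finset.univ.sup c₁ + m)
  have hlog2 : 0 < Real.log 2 := Real.log_pos (by norm_num)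
  refine ⟨A * (E * (2 / Real.log 2 * B' + 1 / Real.log 2) + 1 / Real.log 2) + |c| * B,
    fun x => ?_⟩
  obtain ⟨z, hz⟩ := hc fun j => π j x
  obtain ⟨k, hk⟩ : ∃ k : Fin K → ℕ, ∀ j, k j = condComplexity U (π j x) z := ⟨_, fun _ => rfl⟩
  obtain ⟨x', hx'⟩ := hA x z k hk
  refine ⟨x', fun J _ => ?_⟩
  set N := tupleComplexity U x Finset.univ with hN
  have hNpos : (0 : ℝ) ≤ N := Nat.cast_nonneg _
  set L := Real.log ((N : ℝ) + 2) with hL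
  have hL2 : Real.log 2 ≤ L := Real.log_le_log (by norm_num) (by linarith)
  have hL1 : 1 ≤ 1 / Real.log 2 * L := by
    rw [div_mul_eq_mul_div, one_mul, le_div_iff₀ hlog2]
    linarith
  have hscaled : ∀ j, |(k j : ℝ) - lam * complexity U (π j x)| ≤ |c| * B * L := by
    intro j
    rw [hk j]
    have h0 : tupleComplexity U (fun j => π j x) Finset.univ ≤ (3 + c₀) * (N + 2) := by
      have h1 := hc₀ x []
      have h2 : condComplexity U (π (ε Finset.univ) x) [] = N := hπε x Finset.univ
      rw [h2] at h1
      refine h1.trans ?_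
      nlinarith
    have hpos : 0 ≤ Real.log ((tupleComplexity U (fun j => π j x) Finset.univ : ℝ) + 2) :=
      Real.log_nonneg (by
        linarith [Nat.cast_nonneg (α := ℝ) (tupleComplexity U (fun j => π j x) Finset.univ)])
    calc _ ≤ c * Real.log ((tupleComplexity U (fun j => π j x) Finset.univ : ℝ) + 2) := hz j
      _ ≤ |c| * Real.log ((tupleComplexity U (fun j => π j x) Finset.univ : ℝ) + 2) :=
        mul_le_mul_of_nonneg_right (le_abs_self c) hpos
      _ ≤ |c| * (B * L) := mul_le_mul_of_nonneg_left (hB _ _ h0) (abs_nonneg c)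
      _ = _ := by ring
  obtain ⟨M, hM⟩ : ∃ M, M = (3 + Finset.univ.sup c₁ + m) * (N + 2) := ⟨_, rfl⟩
  have hkM : ∀ j, k j ≤ M := by
    intro j
    have h1 : complexity U (π j x) ≤ (3 + Finset.univ.sup c₁) * (N + 2) := by
      have h1 := hc₁ j x []
      have h2 : condComplexity U (π (ε Finset.univ) x) [] = N := hπε x Finset.univ
      have h3 : c₁ j ≤ Finset.univ.sup c₁ := Finset.le_sup (Finset.mem_univ j)
      rw [h2] at h1
      refine h1.trans ?_
      nlinarith
    have h2 : (complexity U (π j x) : ℝ) ≤ (3 + Finset.univ.sup c₁ : ℕ) * (N + 2) := by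
      exact_mod_cast h1
    have h3 := (abs_le.1 (hscaled j)).2
    have h4 : lam * complexity U (π j x) ≤ complexity U (π j x) :=
      mul_le_of_le_one_left (Nat.cast_nonneg _) hlam1.le
    have h5 : |c| * B * L ≤ m * (N + 2) := by
      refine mul_le_mul hm ?_ (by linarith) (Nat.cast_nonneg _)
      linarith [Real.log_le_sub_one_of_pos (show (0 : ℝ) < N + 2 by linarith)]
    have h6 : (k j : ℝ) ≤ ((3 + Finset.univ.sup c₁ : ℕ) + m) * (N + 2) := by linarith
    rw [hM]
    exact_mod_cast h6
  have hsize : (Nat.size M : ℝ) ≤ 2 / Real.log 2 * B' * L := by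
    refine (size_le_log M).trans ?_
    rw [mul_assoc]
    exact mul_le_mul_of_nonneg_left (hB' N M hM.le) (by positivity)
  have hcode : (codeSize k : ℝ) + 1 ≤
      (E * (2 / Real.log 2 * B' + 1 / Real.log 2) + 1 / Real.log 2) * L := by
    have h1 : (codeSize k : ℝ) ≤ E * (Nat.size M + 1) := by exact_mod_cast hE k M hkM
    have h2 : (E : ℝ) * (Nat.size M + 1) ≤ E * (2 / Real.log 2 * B' * L + 1 / Real.log 2 * L) :=
      mul_le_mul_of_nonneg_left (add_le_add hsize hL1) (Nat.cast_nonneg _)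
    calc (codeSize k : ℝ) + 1 ≤ E * (2 / Real.log 2 * B' * L + 1 / Real.log 2 * L) +
        1 / Real.log 2 * L := by linarith
      _ = _ := by ring
  have hclose : |(complexity U (π (ε J) x') : ℝ) - k (ε J)| ≤ A * (codeSize k + 1) := by
    obtain ⟨h1, h2⟩ := hx' (ε J)
    have h1' : (complexity U (π (ε J) x') : ℝ) ≤ k (ε J) + A * (codeSize k + 1) := by
      exact_mod_cast h1
    have h2' : (k (ε J) : ℝ) ≤ complexity U (π (ε J) x') + A * (codeSize k + 1) := by
      exact_mod_cast h2
    rw [abs_le]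
    constructor <;> linarith
  have hfin := hscaled (ε J)
  rw [← hπε x' J, ← hπε x J]
  refine (abs_sub_le _ (k (ε J) : ℝ) _).trans ((add_le_add hclose hfin).trans ?_)
  have := mul_le_mul_of_nonneg_left hcode (Nat.cast_nonneg (α := ℝ) A)
  linarith
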